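/- **Setting.** Types are generated from the type $0$ of natural numbers and a unit type $1$ by $\rho\to\sigma$ and $\rho\times\sigma$. Terms are those of the typed $\lambda$-calculus with abstraction, application, pairs $(t,s)$, projections $t_1,t_2$, a constant of type $1$, the constants $0$ and $S$, and primitive recursion at every type; terms are identified up to the conversion (congruence) generated by $\beta$, the projection equations and the recursion equations, in the sense that $A(t)$ may be inferred from $A(s)$ when $s$ and $t$ are convertible. Prime formulas are $\bot$ and equations $t=_0s$ between terms of type $0$; formulas are built by $\wedge,\vee,\to$ and by $\forall x^\rho,\exists x^\rho$ for all types $\rho$; $\neg A:=A\to\bot$. $\mathrm{HA}^\omega$ is intuitionistic natural deduction for this many-sorted language with reflexivity and replacement for $=_0$, the Peano axioms for $S$, and induction for all formulas. $\mathrm{PA}^\omega$ is $\mathrm{HA}^\omega$ with the schema $A\vee\neg A$. Consider the schemata (with parameters) $$\mathrm{DNS}^\rho:\ \forall x^\rho\neg\neg A(x)\to\neg\neg\forall x^\rho A(x),\qquad \mathrm{AC}^{\rho,\sigma}:\ \forall x^\rho\exists y^\sigma A(x,y)\to\exists f^{\rho\to\sigma}\forall x^\rho A(x,f(x)).$$ $\mathrm{DNS}^\omega$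 and $\mathrm{AC}^\omega$ denote all instances at all types; $\mathrm{AC}^0$ denotes $\mathrm{AC}^{0,\sigma}$ for all $\sigma$. A formula is arithmetical if all its quantifiers have type $0$. Modified realizability assigns to a formula $A$ and a term $t$, of a type determined by the logical form of $A$, the formula $t\ \mathrm{mr}\ A$: for prime $P$, $t\ \mathrm{mr}\ P:=P$ with $t$ of type $1$; $t\ \mathrm{mr}\ (A\wedge B):=(t_1\ \mathrm{mr}\ A)\wedge(t_2\ \mathrm{mr}\ B)$; $t\ \mathrm{mr}\ (A\vee B):=(t_2=_00\to (t_1)_1\ \mathrm{mr}\ A)\wedge(t_2\neq_00\to (t_1)_2\ \mathrm{mr}\ B)$; $t\ \mathrm{mr}\ (A\to B):=\forall x(x\ \mathrm{mr}\ A\to tx\ \mathrm{mr}\ B)$; $t\ \mathrm{mr}\ \exists yA(y):=t_1\ \mathrm{mr}\ A(t_2)$; $t\ \mathrm{mr}\ \forall yA(y):=\forall y(ty\ \mathrm{mr}\ A(y))$. To every proof $d$ without excluded middle of a formula $B$, from instances of $\mathrm{AC}$ and $\mathrm{DNS}$, the usual recursion on $d$ assigns an extracted term $t_d$ of the type of realizers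 of $B$ (an instance of $\mathrm{AC}$ is assigned $\lambda g.(\lambda x.(gx)_1,\lambda x.(gx)_2)$, and an instance of $\mathrm{DNS}$ the constant functional with value in the unit type), whose free variables are among those of $d$. **Corollary.** Let $A$ be a formula, possibly with free variables. 1. If $\mathrm{PA}^\omega+\mathrm{AC}^\omega$ proves $A$, then $\mathrm{HA}^\omega+\mathrm{AC}^\omega+\mathrm{DNS}^\omega$ proves $\neg\neg A$, and for every proof $d$ of $\neg\neg A$ in $\mathrm{HA}^\omega+\mathrm{AC}^\omega+\mathrm{DNS}^\omega$ the extracted term $t_d$ realizes $\neg\neg A$ provably in that theory: $\mathrm{HA}^\omega+\mathrm{AC}^\omega+\mathrm{DNS}^\omega\vdash t_d\ \mathrm{mr}\ \neg\neg A$. 2. If $A$ is arithmetical and Classical Analysis $\mathrm{PA}^\omega+\mathrm{AC}^0$ proves $A$, then $\mathrm{HA}^\omega+\mathrm{AC}^0+\mathrm{DNS}^0$ proves $\neg\neg A$, and for every proof $d$ of $\neg\neg A$ in $\mathrm{HA}^\omega+\mathrm{AC}^0+\mathrm{DNS}^0$ one has $\mathrm{HA}^\omega+\mathrm{AC}^0+\mathrm{DNS}^0\vdash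 t_d\ \mathrm{mr}\ \neg\neg A$. -/

import Mathlib

namespace HAOmega

/-! ### Finite types and the typed lambda calculus of terms -/

/-- Finite types: the type `0` of natural numbers, the unit type, arrow and product types. -/
inductive Ty : Type
  | nat : Ty
  | unit : Ty
  | arr : Ty → Ty → Ty
  | prod : Ty → Ty → Ty

/-- Typed contexts of free (de Bruijn) variables. -/
abbrev Ctx : Type := List Ty

/-- `Var l a` is the type of positions in the list `l` at which `a` stands. It serves as the type
of variables of a context, and as the type of references to the open assumptions of a proof. -/
inductive Var {α : Type} : List α → α → Type
  | zero {l : List α} {a : α} : Var (a :: l) a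
  | succ {l : List α} {a b : α} : Var l a → Var (b :: l) a

/-- Well-typed terms; `primrec` is the recursor, at an arbitrary type. -/
inductive Term : Ctx → Ty → Type
  | var {Γ : Ctx} {σ : Ty} : Var Γ σ → Term Γ σ
  | lam {Γ : Ctx} {σ τ : Ty} : Term (σ :: Γ) τ → Term Γ (.arr σ τ)
  | app {Γ : Ctx} {σ τ : Ty} : Term Γ (.arr σ τ) → Term Γ σ → Term Γ τ
  | pair {Γ : Ctx} {σ τ : Ty} : Term Γ σ → Term Γ τ → Term Γ (.prod σ τ)
  | fst {Γ : Ctx} {σ τ : Ty} : Term Γ (.prod σ τ) → Term Γ σ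
  | snd {Γ : Ctx} {σ τ : Ty} : Term Γ (.prod σ τ) → Term Γ τ
  | star {Γ : Ctx} : Term Γ .unit
  | zero {Γ : Ctx} : Term Γ .nat
  | succ {Γ : Ctx} : Term Γ .nat → Term Γ .nat
  | primrec {Γ : Ctx} {σ : Ty} :
      Term Γ σ → Term Γ (.arr .nat (.arr σ σ)) → Term Γ .nat → Term Γ σ

/-- Renamings of variables. -/
abbrev Ren (Γ Γ' : Ctx) : Type := ∀ σ : Ty, Var Γ σ → Var Γ' σ

/-- Extension of a renaming under a binder. -/
def Ren.lift {Γ Γ' : Ctx} (r : Ren Γ Γ') (τ : Ty) : Ren (τ :: Γ) (τ :: Γ')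
  | _, .zero => .zero
  | _, .succ v => .succ (r _ v)

/-- The renaming that adds a fresh variable. -/
def Ren.wk {Γ : Ctx} (τ : Ty) : Ren Γ (τ :: Γ) := fun _ v => .succ v

def Term.rename {Γ : Ctx} {σ : Ty} : Term Γ σ → {Γ' : Ctx} → Ren Γ Γ' → Term Γ' σ
  | .var v, _, r => .var (r _ v)
  | .lam t, _, r => .lam (t.rename (r.lift _))
  | .app t u, _, r => .app (t.rename r) (u.rename r)
  | .pair t u, _, r => .pair (t.rename r) (u.rename r)
  | .fst t, _, r => .fst (t.rename r)
  | .snd t, _, r => .snd (t.rename r)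
  | .star, _, _ => .star
  | .zero, _, _ => .zero
  | .succ t, _, r => .succ (t.rename r)
  | .primrec t u n, _, r => .primrec (t.rename r) (u.rename r) (n.rename r)

/-- Weakening of a term by a fresh variable. -/
def Term.wk {Γ : Ctx} {σ : Ty} (τ : Ty) (t : Term Γ σ) : Term (τ :: Γ) σ := t.rename (Ren.wk τ)

/-- Simultaneous substitutions. -/
abbrev Sub (Γ Γ' : Ctx) : Type := ∀ σ : Ty, Var Γ σ → Term Γ' σ

/-- The identity substitution. -/
def Sub.id (Γ : Ctx) : Sub Γ Γ := fun _ v => .var v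

/-- Weakening of all values of a substitution by a fresh variable. -/
def Sub.wk {Γ Γ' : Ctx} (r : Sub Γ Γ') (τ : Ty) : Sub Γ (τ :: Γ') := fun _ v => (r _ v).wk τ

/-- Extension of a substitution by a value for one more variable. -/
def Sub.cons {Γ Γ' : Ctx} {τ : Ty} (t : Term Γ' τ) (r : Sub Γ Γ') : Sub (τ :: Γ) Γ'
  | _, .zero => t
  | _, .succ v => r _ v

/-- Extension of a substitution under a binder. -/
def Sub.lift {Γ Γ' : Ctx} (r : Sub Γ Γ') (τ : Ty) : Sub (τ :: Γ) (τ :: Γ') :=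
  Sub.cons (.var .zero) (r.wk τ)

def Term.subst {Γ : Ctx} {σ : Ty} : Term Γ σ → {Γ' : Ctx} → Sub Γ Γ' → Term Γ' σ
  | .var v, _, r => r _ v
  | .lam t, _, r => .lam (t.subst (r.lift _))
  | .app t u, _, r => .app (t.subst r) (u.subst r)
  | .pair t u, _, r => .pair (t.subst r) (u.subst r)
  | .fst t, _, r => .fst (t.subst r)
  | .snd t, _, r => .snd (t.subst r)
  | .star, _, _ => .star
  | .zero, _, _ => .zero
  | .succ t, _, r => .succ (t.subst r)
  | .primrec t u n, _, r => .primrec (t.subst r) (u.subst r) (n.subst r)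

/-- Substitution of `u` for the last variable of `t`. -/
def Term.inst {Γ : Ctx} {σ τ : Ty} (t : Term (τ :: Γ) σ) (u : Term Γ τ) : Term Γ σ :=
  t.subst (Sub.cons u (Sub.id Γ))

/-- Conversion of terms: the congruence generated by beta reduction, by the equations of the
projections and by the equations of the recursor. -/
inductive Conv : {Γ : Ctx} → {σ : Ty} → Term Γ σ → Term Γ σ → Prop
  | refl {Γ : Ctx} {σ : Ty} (t : Term Γ σ) : Conv t t
  | symm {Γ : Ctx} {σ : Ty} {t u : Term Γ σ} : Conv t u → Conv u t
  | trans {Γ : Ctx} {σ : Ty} {t u v : Term Γ σ} : Conv t u → Conv u v → Conv t v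
  | lam {Γ : Ctx} {σ τ : Ty} {t u : Term (σ :: Γ) τ} : Conv t u → Conv (.lam t) (.lam u)
  | app {Γ : Ctx} {σ τ : Ty} {t t' : Term Γ (.arr σ τ)} {u u' : Term Γ σ} :
      Conv t t' → Conv u u' → Conv (.app t u) (.app t' u')
  | pair {Γ : Ctx} {σ τ : Ty} {t t' : Term Γ σ} {u u' : Term Γ τ} :
      Conv t t' → Conv u u' → Conv (.pair t u) (.pair t' u')
  | fst {Γ : Ctx} {σ τ : Ty} {t u : Term Γ (.prod σ τ)} : Conv t u → Conv (.fst t) (.fst u)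
  | snd {Γ : Ctx} {σ τ : Ty} {t u : Term Γ (.prod σ τ)} : Conv t u → Conv (.snd t) (.snd u)
  | succ {Γ : Ctx} {t u : Term Γ .nat} : Conv t u → Conv (.succ t) (.succ u)
  | primrec {Γ : Ctx} {σ : Ty} {t t' : Term Γ σ} {u u' : Term Γ (.arr .nat (.arr σ σ))}
      {n n' : Term Γ .nat} :
      Conv t t' → Conv u u' → Conv n n' → Conv (.primrec t u n) (.primrec t' u' n')
  | beta {Γ : Ctx} {σ τ : Ty} (t : Term (σ :: Γ) τ) (u : Term Γ σ) :
      Conv (.app (.lam t) u) (t.inst u)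
  | fst_pair {Γ : Ctx} {σ τ : Ty} (t : Term Γ σ) (u : Term Γ τ) : Conv (.fst (.pair t u)) t
  | snd_pair {Γ : Ctx} {σ τ : Ty} (t : Term Γ σ) (u : Term Γ τ) : Conv (.snd (.pair t u)) u
  | primrec_zero {Γ : Ctx} {σ : Ty} (t : Term Γ σ) (u : Term Γ (.arr .nat (.arr σ σ))) :
      Conv (.primrec t u .zero) t
  | primrec_succ {Γ : Ctx} {σ : Ty} (t : Term Γ σ) (u : Term Γ (.arr .nat (.arr σ σ)))
      (n : Term Γ .nat) :
      Conv (.primrec t u (.succ n)) (.app (.app u n) (.primrec t u n))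

/-- A closed inhabitant of every type, used where a realizer is computationally irrelevant. -/
def Term.dflt {Γ : Ctx} : (σ : Ty) → Term Γ σ
  | .nat => .zero
  | .unit => .star
  | .arr _ τ => .lam (Term.dflt τ)
  | .prod σ τ => .pair (Term.dflt σ) (Term.dflt τ)

/-- Definition by cases: `t` if `n = 0`, and `u` if `n` is a successor. -/
def Term.cond {Γ : Ctx} {σ : Ty} (n : Term Γ .nat) (t u : Term Γ σ) : Term Γ σ :=
  .primrec t (.lam (.lam ((u.wk _).wk _))) n

/-! ### Formulas -/

/-- The logical form of a formula: the formula with all its terms forgotten. -/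
inductive Form : Type
  | prime : Form
  | and : Form → Form → Form
  | or : Form → Form → Form
  | imp : Form → Form → Form
  | all : Ty → Form → Form
  | ex : Ty → Form → Form

/-- Formulas with free variables in `Γ`. The second index only records the logical form of the
formula (it is determined by the formula). The prime formulas are the equations between terms of
type `0`, and falsity. -/
inductive Fm : Ctx → Form → Type
  | eq {Γ : Ctx} : Term Γ .nat → Term Γ .nat → Fm Γ .prime
  | bot {Γ : Ctx} : Fm Γ .prime
  | and {Γ : Ctx} {a b : Form} : Fm Γ a → Fm Γ b → Fm Γ (.and a b)
  | or {Γ : Ctx} {a b : Form} : Fm Γ a → Fm Γ b → Fm Γ (.or a b)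
  | imp {Γ : Ctx} {a b : Form} : Fm Γ a → Fm Γ b → Fm Γ (.imp a b)
  | all {Γ : Ctx} {σ : Ty} {a : Form} : Fm (σ :: Γ) a → Fm Γ (.all σ a)
  | ex {Γ : Ctx} {σ : Ty} {a : Form} : Fm (σ :: Γ) a → Fm Γ (.ex σ a)

/-- Logical form of a negation. -/
abbrev Form.neg (a : Form) : Form := .imp a .prime

/-- Negation. -/
abbrev Fm.neg {Γ : Ctx} {a : Form} (A : Fm Γ a) : Fm Γ a.neg := .imp A .bot

def Fm.subst {Γ : Ctx} {a : Form} : Fm Γ a → {Γ' : Ctx} → Sub Γ Γ' → Fm Γ' a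
  | .eq t u, _, r => .eq (t.subst r) (u.subst r)
  | .bot, _, _ => .bot
  | .and A B, _, r => .and (A.subst r) (B.subst r)
  | .or A B, _, r => .or (A.subst r) (B.subst r)
  | .imp A B, _, r => .imp (A.subst r) (B.subst r)
  | .all A, _, r => .all (A.subst (r.lift _))
  | .ex A, _, r => .ex (A.subst (r.lift _))

/-- Weakening of a formula by a fresh variable. -/
def Fm.wk {Γ : Ctx} {a : Form} (τ : Ty) (A : Fm Γ a) : Fm (τ :: Γ) a :=
  A.subst ((Sub.id Γ).wk τ)

/-- The formula `A(t)`, for a formula `A(x)` whose last variable is `x`. -/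
def Fm.inst {Γ : Ctx} {a : Form} {τ : Ty} (A : Fm (τ :: Γ) a) (t : Term Γ τ) : Fm Γ a :=
  A.subst (Sub.cons t (Sub.id Γ))

/-- The formula `A(S x)`, for a formula `A(x)` whose last variable is `x` of type `0`. -/
def Fm.step {Γ : Ctx} {a : Form} (A : Fm (.nat :: Γ) a) : Fm (.nat :: Γ) a :=
  A.subst (Sub.cons (.succ (.var .zero)) ((Sub.id Γ).wk .nat))

/-- A formula is arithmetical if it contains only quantifiers of type `0`. -/
def Form.Arithmetical : Form → Prop
  | .prime => True
  | .and a b => a.Arithmetical ∧ b.Arithmetical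
  | .or a b => a.Arithmetical ∧ b.Arithmetical
  | .imp a b => a.Arithmetical ∧ b.Arithmetical
  | .all σ a => σ = .nat ∧ a.Arithmetical
  | .ex σ a => σ = .nat ∧ a.Arithmetical

/-! ### The principles of choice and of double-negation shift -/

/-- The substitution `x ↦ x, y ↦ f x`, where `x, y` are the last two variables of the source
context, and `f, x` the last two variables of the target context. -/
def choiceSub (Γ : Ctx) (ρ σ : Ty) : Sub (σ :: ρ :: Γ) (ρ :: Ty.arr ρ σ :: Γ) :=
  Sub.cons (.app (.var (.succ .zero)) (.var .zero)) (((Sub.id Γ).wk (.arr ρ σ)).lift ρ)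

/-- The instance of the axiom of choice for `A(x, y)`, with `x` of type `ρ` and `y` of type `σ`:
`∀ x ∃ y A(x, y) → ∃ f ∀ x A(x, f x)`. -/
def acFm {Γ : Ctx} {ρ σ : Ty} {a : Form} (A : Fm (σ :: ρ :: Γ) a) :
    Fm Γ (.imp (.all ρ (.ex σ a)) (.ex (.arr ρ σ) (.all ρ a))) :=
  .imp (.all (.ex A)) (.ex (.all (A.subst (choiceSub Γ ρ σ))))

/-- The instance of the double-negation shift for `A(x)`, with `x` of type `ρ`:
`∀ x ¬¬ A(x) → ¬¬ ∀ x A(x)`. -/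
def dnsFm {Γ : Ctx} {ρ : Ty} {a : Form} (A : Fm (ρ :: Γ) a) :
    Fm Γ (.imp (.all ρ a.neg.neg) (Form.all ρ a).neg.neg) :=
  .imp (.all A.neg.neg) (Fm.all A).neg.neg

/-! ### Natural deduction -/

/-- Lists of open assumptions with free variables in `Γ`. -/
inductive Hyps (Γ : Ctx) : List Form → Type
  | nil : Hyps Γ []
  | cons {a : Form} {l : List Form} : Fm Γ a → Hyps Γ l → Hyps Γ (a :: l)

def Hyps.get {Γ : Ctx} : {l : List Form} → Hyps Γ l → {a : Form} → Var l a → Fm Γ a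
  | _, .cons A _, _, .zero => A
  | _, .cons _ Δ, _, .succ i => Δ.get i

/-- Weakening of all assumptions by a fresh variable. -/
def Hyps.wk {Γ : Ctx} (τ : Ty) : {l : List Form} → Hyps Γ l → Hyps (τ :: Γ) l
  | _, .nil => .nil
  | _, .cons A Δ => .cons (A.wk τ) (Δ.wk τ)

/-- An extension of higher-type intuitionistic arithmetic: whether it has the law of excluded
middle, and at which types it has the axiom of choice and the double-negation shift. -/
structure Theory where
  lem : Prop
  ac : Ty → Ty → Prop
  dns : Ty → Prop

/-- Natural deduction derivations from open assumptions in the theory `S`: the rules of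
intuitionistic many-sorted predicate logic, equality at type `0`, conversion of terms, the Peano
axioms with full induction, and the additional schemata of `S`. -/
inductive Deriv (S : Theory) :
    {Γ : Ctx} → {l : List Form} → Hyps Γ l → {a : Form} → Fm Γ a → Type
  | hyp {Γ : Ctx} {l : List Form} {Δ : Hyps Γ l} {a : Form} (i : Var l a) : Deriv S Δ (Δ.get i)
  | andI {Γ : Ctx} {l : List Form} {Δ : Hyps Γ l} {a b : Form} {A : Fm Γ a} {B : Fm Γ b} :
      Deriv S Δ A → Deriv S Δ B → Deriv S Δ (.and A B)
  | andE1 {Γ : Ctx} {l : List Form} {Δ : Hyps Γ l} {a b : Form} {A : Fm Γ a} {B : Fm Γ b} :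
      Deriv S Δ (.and A B) → Deriv S Δ A
  | andE2 {Γ : Ctx} {l : List Form} {Δ : Hyps Γ l} {a b : Form} {A : Fm Γ a} {B : Fm Γ b} :
      Deriv S Δ (.and A B) → Deriv S Δ B
  | orI1 {Γ : Ctx} {l : List Form} {Δ : Hyps Γ l} {a b : Form} {A : Fm Γ a} {B : Fm Γ b} :
      Deriv S Δ A → Deriv S Δ (.or A B)
  | orI2 {Γ : Ctx} {l : List Form} {Δ : Hyps Γ l} {a b : Form} {A : Fm Γ a} {B : Fm Γ b} :
      Deriv S Δ B → Deriv S Δ (.or A B)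
  | orE {Γ : Ctx} {l : List Form} {Δ : Hyps Γ l} {a b c : Form} {A : Fm Γ a} {B : Fm Γ b}
      {C : Fm Γ c} :
      Deriv S Δ (.or A B) → Deriv S (.cons A Δ) C → Deriv S (.cons B Δ) C → Deriv S Δ C
  | impI {Γ : Ctx} {l : List Form} {Δ : Hyps Γ l} {a b : Form} {A : Fm Γ a} {B : Fm Γ b} :
      Deriv S (.cons A Δ) B → Deriv S Δ (.imp A B)
  | impE {Γ : Ctx} {l : List Form} {Δ : Hyps Γ l} {a b : Form} {A : Fm Γ a} {B : Fm Γ b} :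
      Deriv S Δ (.imp A B) → Deriv S Δ A → Deriv S Δ B
  | allI {Γ : Ctx} {l : List Form} {Δ : Hyps Γ l} {σ : Ty} {a : Form} {A : Fm (σ :: Γ) a} :
      Deriv S (Δ.wk σ) A → Deriv S Δ (.all A)
  | allE {Γ : Ctx} {l : List Form} {Δ : Hyps Γ l} {σ : Ty} {a : Form} {A : Fm (σ :: Γ) a}
      (t : Term Γ σ) : Deriv S Δ (.all A) → Deriv S Δ (A.inst t)
  | exI {Γ : Ctx} {l : List Form} {Δ : Hyps Γ l} {σ : Ty} {a : Form} {A : Fm (σ :: Γ) a}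
      (t : Term Γ σ) : Deriv S Δ (A.inst t) → Deriv S Δ (.ex A)
  | exE {Γ : Ctx} {l : List Form} {Δ : Hyps Γ l} {σ : Ty} {a c : Form} {A : Fm (σ :: Γ) a}
      {C : Fm Γ c} :
      Deriv S Δ (.ex A) → Deriv S (.cons A (Δ.wk σ)) (C.wk σ) → Deriv S Δ C
  | botE {Γ : Ctx} {l : List Form} {Δ : Hyps Γ l} {a : Form} {A : Fm Γ a} :
      Deriv S Δ .bot → Deriv S Δ A
  | eqRefl {Γ : Ctx} {l : List Form} {Δ : Hyps Γ l} (t : Term Γ .nat) : Deriv S Δ (.eq t t)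
  | eqSubst {Γ : Ctx} {l : List Form} {Δ : Hyps Γ l} {a : Form} (A : Fm (.nat :: Γ) a)
      {t u : Term Γ .nat} :
      Deriv S Δ (.eq t u) → Deriv S Δ (A.inst t) → Deriv S Δ (A.inst u)
  | conv {Γ : Ctx} {l : List Form} {Δ : Hyps Γ l} {σ : Ty} {a : Form} (A : Fm (σ :: Γ) a)
      {t u : Term Γ σ} : Conv t u → Deriv S Δ (A.inst t) → Deriv S Δ (A.inst u)
  | succNeZero {Γ : Ctx} {l : List Form} {Δ : Hyps Γ l} {t : Term Γ .nat} :
      Deriv S Δ (.eq (.succ t) .zero) → Deriv S Δ .bot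
  | succInj {Γ : Ctx} {l : List Form} {Δ : Hyps Γ l} {t u : Term Γ .nat} :
      Deriv S Δ (.eq (.succ t) (.succ u)) → Deriv S Δ (.eq t u)
  | ind {Γ : Ctx} {l : List Form} {Δ : Hyps Γ l} {a : Form} {A : Fm (.nat :: Γ) a} :
      Deriv S Δ (A.inst .zero) → Deriv S Δ (.all (.imp A A.step)) → Deriv S Δ (.all A)
  | lem {Γ : Ctx} {l : List Form} {Δ : Hyps Γ l} {a : Form} (h : S.lem) (A : Fm Γ a) :
      Deriv S Δ (.or A A.neg)
  | ac {Γ : Ctx} {l : List Form} {Δ : Hyps Γ l} {ρ σ : Ty} {a : Form} (h : S.ac ρ σ)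
      (A : Fm (σ :: ρ :: Γ) a) : Deriv S Δ (acFm A)
  | dns {Γ : Ctx} {l : List Form} {Δ : Hyps Γ l} {ρ : Ty} {a : Form} (h : S.dns ρ)
      (A : Fm (ρ :: Γ) a) : Deriv S Δ (dnsFm A)

/-- A proof of `A` in `S`: a derivation without open assumptions. -/
abbrev Proof (S : Theory) {Γ : Ctx} {a : Form} (A : Fm Γ a) : Type := Deriv S Hyps.nil A

/-- The theory `S` proves `A`. -/
def Provable (S : Theory) {Γ : Ctx} {a : Form} (A : Fm Γ a) : Prop := Nonempty (Proof S A)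

/-- `PA^ω + AC^ω`. -/
def PA_ACω : Theory where
  lem := True
  ac _ _ := True
  dns _ := False

/-- `HA^ω + AC^ω + DNS^ω`. -/
def HA_ACω_DNSω : Theory where
  lem := False
  ac _ _ := True
  dns _ := True

/-- Classical Analysis, `PA^ω + AC^0`: choice over type `0`, with values of any type. -/
def PA_AC0 : Theory where
  lem := True
  ac ρ _ := ρ = .nat
  dns _ := False

/-- `HA^ω + AC^0 + DNS^0`. -/
def HA_AC0_DNS0 : Theory where
  lem := False
  ac ρ _ := ρ = .nat
  dns ρ := ρ = .nat

/-! ### Modified realizability -/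

/-- The type of the realizers of a formula, determined by its logical form. -/
@[reducible] def Form.rty : Form → Ty
  | .prime => .unit
  | .and a b => .prod a.rty b.rty
  | .or a b => .prod (.prod a.rty b.rty) .nat
  | .imp a b => .arr a.rty b.rty
  | .all σ a => .arr σ a.rty
  | .ex σ a => .prod a.rty σ

/-- The logical form of the formula `t mr A`. -/
@[reducible] def Form.mr : Form → Form
  | .prime => .prime
  | .and a b => .and a.mr b.mr
  | .or a b => .and (.imp .prime a.mr) (.imp (Form.neg .prime) b.mr)
  | .imp a b => .all a.rty (.imp a.mr b.mr)
  | .all σ a => .all σ a.mr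
  | .ex _ a => a.mr

/-- The formula `t mr A`: the term `t` interprets `A` by modified realizability. -/
def mr : {a : Form} → {Γ : Ctx} → Term Γ a.rty → Fm Γ a → Fm Γ a.mr
  | .prime, _, _, P => P
  | .and a b, _, t, .and A B => .and (mr (a := a) (.fst t) A) (mr (a := b) (.snd t) B)
  | .or a b, _, t, .or A B =>
      .and (.imp (.eq (.snd t) .zero) (mr (a := a) (.fst (.fst t)) A))
        (.imp (Fm.neg (.eq (.snd t) .zero)) (mr (a := b) (.snd (.fst t)) B))
  | .imp a b, _, t, .imp A B =>
      .all (.imp (mr (a := a) (.var .zero) (A.wk _))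
        (mr (a := b) (.app (t.wk _) (.var .zero)) (B.wk _)))
  | .all _ a, _, t, .all A => .all (mr (a := a) (.app (t.wk _) (.var .zero)) A)
  | .ex _ a, _, t, .ex A => mr (a := a) (.fst t) (A.inst (.snd t))

/-! ### Program extraction -/

/-- Realizers, with free variables in `Γ`, for a list of open assumptions. -/
abbrev Realizers (Γ : Ctx) (l : List Form) : Type := ∀ a : Form, Var l a → Term Γ a.rty

def Realizers.nil {Γ : Ctx} : Realizers Γ [] := fun _ i => nomatch i

def Realizers.cons {Γ : Ctx} {l : List Form} {a : Form} (t : Term Γ a.rty) (e : Realizers Γ l) :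
    Realizers Γ (a :: l)
  | _, .zero => t
  | _, .succ i => e _ i

def Realizers.wk {Γ : Ctx} {l : List Form} (e : Realizers Γ l) (τ : Ty) :
    Realizers (τ :: Γ) l := fun _ i => (e _ i).wk τ

/-- The term extracted by modified realizability from a derivation without excluded middle, given
values `r` of the free variables and realizers `e` of the open assumptions. -/
def Deriv.extractAux {S : Theory} (hS : ¬ S.lem) {Γ : Ctx} {l : List Form} {Δ : Hyps Γ l}
    {a : Form} {A : Fm Γ a} :
    Deriv S Δ A → {Γ' : Ctx} → Sub Γ Γ' → Realizers Γ' l → Term Γ' a.rty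
  | .hyp i, _, _, e => e _ i
  | .andI p q, _, r, e => .pair (p.extractAux hS r e) (q.extractAux hS r e)
  | .andE1 p, _, r, e => .fst (p.extractAux hS r e)
  | .andE2 p, _, r, e => .snd (p.extractAux hS r e)
  | .orI1 p, _, r, e => .pair (.pair (p.extractAux hS r e) (.dflt _)) .zero
  | .orI2 p, _, r, e => .pair (.pair (.dflt _) (p.extractAux hS r e)) (.succ .zero)
  | .orE p q q', _, r, e =>
      .cond (.snd (p.extractAux hS r e))
        (q.extractAux hS r (e.cons (.fst (.fst (p.extractAux hS r e)))))
        (q'.extractAux hS r (e.cons (.snd (.fst (p.extractAux hS r e)))))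
  | .impI p, _, r, e => .lam (p.extractAux hS (r.wk _) ((e.wk _).cons (.var .zero)))
  | .impE p q, _, r, e => .app (p.extractAux hS r e) (q.extractAux hS r e)
  | .allI p, _, r, e => .lam (p.extractAux hS (r.lift _) (e.wk _))
  | .allE t p, _, r, e => .app (p.extractAux hS r e) (t.subst r)
  | .exI t p, _, r, e => .pair (p.extractAux hS r e) (t.subst r)
  | .exE p q, _, r, e =>
      q.extractAux hS (Sub.cons (.snd (p.extractAux hS r e)) r)
        (e.cons (.fst (p.extractAux hS r e)))
  | .botE _, _, _, _ => .dflt _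
  | .eqRefl _, _, _, _ => .star
  | .eqSubst _ _ q, _, r, e => q.extractAux hS r e
  | .conv _ _ q, _, r, e => q.extractAux hS r e
  | .succNeZero _, _, _, _ => .star
  | .succInj _, _, _, _ => .star
  | .ind p q, _, r, e =>
      .lam (.primrec ((p.extractAux hS r e).wk _) ((q.extractAux hS r e).wk _) (.var .zero))
  | .lem h _, _, _, _ => absurd h hS
  | .ac _ _, _, _, _ =>
      .lam (.pair (.lam (.fst (.app (.var (.succ .zero)) (.var .zero))))
        (.lam (.snd (.app (.var (.succ .zero)) (.var .zero)))))
  | .dns _ _, _, _, _ => .dflt _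

/-- The term extracted by modified realizability from a proof without excluded middle; its free
variables are among those of the proof. -/
def Deriv.extract {S : Theory} (hS : ¬ S.lem) {Γ : Ctx} {a : Form} {A : Fm Γ a}
    (d : Proof S A) : Term Γ a.rty :=
  d.extractAux hS (Sub.id Γ) Realizers.nil

theorem not_lem_HA_ACω_DNSω : ¬ HA_ACω_DNSω.lem := fun h => h

theorem not_lem_HA_AC0_DNS0 : ¬ HA_AC0_DNS0.lem := fun h => h

end HAOmega

/-!
The Gödel–Gentzen negative translation turns every formula into one that is implied by its own
double negation. Hence a translated instance of choice, whose premise is `∀ x ¬¬ ∃ y A`, follows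
from choice itself as soon as that premise yields `¬¬ ∀ x ∃ y A`, which is double-negation shift.
Double-negation shift at the types of the universal quantifiers in positive position is also what
turns the translation of a formula into its double negation: this concerns arbitrary types for an
arbitrary formula, but only the type `0` for an arithmetical one.

Modified realizability is sound by induction on derivations, the only delicate case being
double-negation shift. If `t` realizes `∀ x ¬¬ A` and `u` realizes `¬ ∀ x A`, then `t` gives
`∀ x ¬¬ ∃ y (y mr A)`, double-negation shift gives `¬¬ ∀ x ∃ y (y mr A)`, and choice gives
`¬¬ ∃ f ∀ x (f x mr A)`, which `u` refutes. So in the presence of choice, double-negation shift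
itself shows that any term of the right type realizes it.
-/

namespace HAOmega

/-! ### The calculus of substitutions -/

section Substitution

variable {Γ Γ' Γ'' Γ₃ : Ctx} {σ τ : Ty} {a : Form}

/-- A renaming, seen as a substitution. -/
def Ren.toSub (r : Ren Γ Γ') : Sub Γ Γ' := fun _ v => .var (r _ v)

/-- The substitution that adds a fresh variable. -/
def Sub.shift (τ : Ty) : Sub Γ (τ :: Γ) := (Ren.wk τ).toSub

/-- Composition of substitutions, in diagrammatic order. -/
def Sub.comp (r : Sub Γ Γ') (s : Sub Γ' Γ'') : Sub Γ Γ'' := fun _ v => (r _ v).subst s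

@[simp]
theorem Sub.cons_zero (t : Term Γ' τ) (r : Sub Γ Γ') : Sub.cons t r τ .zero = t := rfl

@[simp]
theorem Sub.cons_succ (t : Term Γ' τ) (r : Sub Γ Γ') (v : Var Γ σ) :
    Sub.cons t r σ (.succ v) = r σ v := rfl

@[simp]
theorem Sub.shift_apply (v : Var Γ σ) : Sub.shift τ σ v = .var (.succ v) := rfl

@[simp]
theorem Sub.wk_id (Γ : Ctx) (τ : Ty) : (Sub.id Γ).wk τ = Sub.shift τ := rfl

@[simp]
theorem Sub.cons_shift (Γ : Ctx) (τ : Ty) :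
    Sub.cons (.var .zero) (Sub.shift τ) = Sub.id (τ :: Γ) := by
  funext σ v
  cases v <;> rfl

@[simp]
theorem Sub.cons_comp (t : Term Γ' τ) (r : Sub Γ Γ') (s : Sub Γ' Γ'') :
    (Sub.cons t r).comp s = Sub.cons (t.subst s) (r.comp s) := by
  funext σ v
  cases v <;> rfl

@[simp]
theorem Sub.shift_comp_cons (t : Term Γ' τ) (r : Sub Γ Γ') :
    (Sub.shift τ).comp (Sub.cons t r) = r := rfl

@[simp]
theorem Sub.id_comp (r : Sub Γ Γ') : (Sub.id Γ).comp r = r := rfl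

theorem Sub.toSub_lift (r : Ren Γ Γ') (τ : Ty) : r.toSub.lift τ = (r.lift τ).toSub := by
  funext σ v
  cases v <;> rfl

theorem Sub.lift_id (Γ : Ctx) (τ : Ty) : (Sub.id Γ).lift τ = Sub.id (τ :: Γ) :=
  Sub.cons_shift Γ τ

attribute [simp] Term.subst Fm.subst

theorem Term.rename_eq_subst (t : Term Γ σ) (r : Ren Γ Γ') : t.rename r = t.subst r.toSub := by
  induction t generalizing Γ' with
  | lam t ih => rw [Term.rename, Term.subst, Sub.toSub_lift, ih]
  | _ => simp only [Term.rename, Term.subst, Ren.toSub, *]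

theorem Term.wk_eq_subst (τ : Ty) (t : Term Γ σ) : t.wk τ = t.subst (Sub.shift τ) :=
  t.rename_eq_subst _

@[simp]
theorem Term.subst_id (t : Term Γ σ) : t.subst (Sub.id Γ) = t := by
  induction t with
  | lam t ih => rw [Term.subst, Sub.lift_id, ih]
  | _ => simp only [Term.subst, Sub.id, *]

theorem Term.subst_rename (t : Term Γ σ) (r : Ren Γ Γ') (s : Sub Γ' Γ'') :
    (t.rename r).subst s = t.subst (fun _ v => s _ (r _ v)) := by
  induction t generalizing Γ' Γ'' with
  | lam t ih =>
    rw [Term.rename, Term.subst, ih, Term.subst]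
    congr 2
    funext σ v
    cases v <;> rfl
  | _ => simp only [Term.rename, Term.subst, *]

theorem Term.rename_subst (t : Term Γ σ) (r : Sub Γ Γ') (s : Ren Γ' Γ'') :
    (t.subst r).rename s = t.subst (fun _ v => (r _ v).rename s) := by
  induction t generalizing Γ' Γ'' with
  | lam t ih =>
    rw [Term.subst, Term.rename, ih, Term.subst]
    congr 2
    funext σ v
    cases v with
    | zero => rfl
    | succ v =>
      change ((r σ v).rename (Ren.wk _)).rename (s.lift _) = ((r σ v).rename s).rename (Ren.wk _)
      rw [Term.rename_eq_subst _ (s.lift _), Term.subst_rename,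
        Term.rename_eq_subst _ (Ren.wk _), Term.subst_rename]
      rfl
  | _ => simp only [Term.rename, Term.subst, *]

theorem Sub.lift_comp_lift (r : Sub Γ Γ') (s : Sub Γ' Γ'') (τ : Ty) :
    (r.lift τ).comp (s.lift τ) = (r.comp s).lift τ := by
  funext σ v
  cases v with
  | zero => rfl
  | succ v =>
    change ((r σ v).rename (Ren.wk τ)).subst (s.lift τ) = ((r σ v).subst s).rename (Ren.wk τ)
    rw [Term.subst_rename, Term.rename_subst]
    rfl

@[simp]
theorem Term.subst_subst (t : Term Γ σ) (r : Sub Γ Γ') (s : Sub Γ' Γ'') :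
    (t.subst r).subst s = t.subst (r.comp s) := by
  induction t generalizing Γ' Γ'' with
  | lam t ih => simp only [Term.subst, ih, Sub.lift_comp_lift]
  | _ => simp only [Term.subst, Sub.comp, *]

@[simp]
theorem Sub.comp_assoc (r : Sub Γ Γ') (s : Sub Γ' Γ'') (q : Sub Γ'' Γ₃) :
    (r.comp s).comp q = r.comp (s.comp q) := by
  funext σ v
  exact Term.subst_subst _ _ _

@[simp]
theorem Sub.comp_id (r : Sub Γ Γ') : r.comp (Sub.id Γ') = r := by
  funext σ v
  exact Term.subst_id _

theorem Sub.wk_eq_comp (r : Sub Γ Γ') (τ : Ty) : r.wk τ = r.comp (Sub.shift τ) := by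
  funext σ v
  exact (r σ v).wk_eq_subst τ

theorem Sub.lift_eq_cons (r : Sub Γ Γ') (τ : Ty) :
    r.lift τ = Sub.cons (.var .zero) (r.comp (Sub.shift τ)) := by
  rw [Sub.lift, Sub.wk_eq_comp]

@[simp]
theorem Fm.subst_id (A : Fm Γ a) : A.subst (Sub.id Γ) = A := by
  induction A with
  | _ => simp only [Fm.subst, Term.subst_id, Sub.lift_id, *]

@[simp]
theorem Fm.subst_subst (A : Fm Γ a) (r : Sub Γ Γ') (s : Sub Γ' Γ'') :
    (A.subst r).subst s = A.subst (r.comp s) := by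
  induction A generalizing Γ' Γ'' with
  | _ => simp only [Fm.subst, Term.subst_subst, Sub.lift_comp_lift, *]

theorem Fm.wk_eq_subst (τ : Ty) (A : Fm Γ a) : A.wk τ = A.subst (Sub.shift τ) := rfl

theorem Term.subst_wk (t : Term Γ σ) (τ : Ty) (r : Sub Γ Γ') :
    (t.wk τ).subst (r.lift τ) = (t.subst r).wk τ := by
  simp [Term.wk_eq_subst, Sub.lift_eq_cons]

theorem Fm.subst_wk (A : Fm Γ a) (τ : Ty) (r : Sub Γ Γ') :
    (A.wk τ).subst (r.lift τ) = (A.subst r).wk τ := by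
  simp [Fm.wk_eq_subst, Sub.lift_eq_cons]

theorem Fm.subst_sub_wk (A : Fm Γ a) (τ : Ty) (r : Sub Γ Γ') :
    A.subst (r.wk τ) = (A.subst r).wk τ := by
  simp [Fm.wk_eq_subst, Sub.wk_eq_comp]

theorem Fm.subst_cons_wk (A : Fm Γ a) (t : Term Γ' τ) (r : Sub Γ Γ') :
    (A.wk τ).subst (Sub.cons t r) = A.subst r := by
  simp [Fm.wk_eq_subst]

theorem Term.inst_subst (t : Term (τ :: Γ) σ) (u : Term Γ τ) (r : Sub Γ Γ') :
    (t.inst u).subst r = (t.subst (r.lift τ)).inst (u.subst r) := by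
  simp [Term.inst, Sub.lift_eq_cons]

theorem Fm.inst_subst (A : Fm (τ :: Γ) a) (t : Term Γ τ) (r : Sub Γ Γ') :
    (A.inst t).subst r = (A.subst (r.lift τ)).inst (t.subst r) := by
  simp [Fm.inst, Sub.lift_eq_cons]

theorem Fm.subst_lift_inst (A : Fm (τ :: Γ) a) (t : Term Γ' τ) (r : Sub Γ Γ') :
    (A.subst (r.lift τ)).inst t = A.subst (Sub.cons t r) := by
  simp [Fm.inst, Sub.lift_eq_cons]

@[simp]
theorem Term.wk_inst (t : Term Γ σ) (u : Term Γ τ) : (t.wk τ).inst u = t := by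
  simp [Term.inst, Term.wk_eq_subst]

@[simp]
theorem Fm.wk_inst (A : Fm Γ a) (u : Term Γ τ) : (A.wk τ).inst u = A := by
  simp [Fm.inst, Fm.wk_eq_subst]

theorem Fm.subst_lift_shift_inst_var_zero (A : Fm (τ :: Γ) a) :
    (A.subst ((Sub.shift τ).lift τ)).inst (.var .zero) = A := by
  rw [Fm.subst_lift_inst, Sub.cons_shift, Fm.subst_id]

theorem Fm.step_subst (A : Fm (.nat :: Γ) a) (r : Sub Γ Γ') :
    A.step.subst (r.lift .nat) = (A.subst (r.lift .nat)).step := by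
  simp [Fm.step, Sub.lift_eq_cons]

theorem choiceSub_eq_cons (Γ : Ctx) (ρ σ : Ty) :
    choiceSub Γ ρ σ = Sub.cons (.app (.var (.succ .zero)) (.var .zero))
      (Sub.cons (.var .zero) ((Sub.shift (.arr ρ σ)).comp (Sub.shift ρ))) := by
  rw [choiceSub, Sub.lift_eq_cons, Sub.wk_id]

theorem acFm_subst {ρ : Ty} (A : Fm (σ :: ρ :: Γ) a) (r : Sub Γ Γ') :
    (acFm A).subst r = acFm (A.subst ((r.lift ρ).lift σ)) := by
  simp [acFm, choiceSub_eq_cons, Sub.lift_eq_cons]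

theorem Term.cond_subst (n : Term Γ .nat) (t u : Term Γ σ) (r : Sub Γ Γ') :
    (Term.cond n t u).subst r = .cond (n.subst r) (t.subst r) (u.subst r) := by
  simp [Term.cond, Term.wk_eq_subst, Sub.lift_eq_cons]

theorem Conv.subst {t u : Term Γ σ} (h : Conv t u) (r : Sub Γ Γ') :
    Conv (t.subst r) (u.subst r) := by
  induction h generalizing Γ' with
  | refl t => exact .refl _
  | symm _ ih => exact .symm (ih r)
  | trans _ _ ih ih' => exact .trans (ih r) (ih' r)
  | lam _ ih => exact .lam (ih _)
  | app _ _ ih ih' => exact .app (ih r) (ih' r)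
  | pair _ _ ih ih' => exact .pair (ih r) (ih' r)
  | fst _ ih => exact .fst (ih r)
  | snd _ ih => exact .snd (ih r)
  | succ _ ih => exact .succ (ih r)
  | primrec _ _ _ ih ih' ih'' => exact .primrec (ih r) (ih' r) (ih'' r)
  | beta t u => exact Term.inst_subst t u r ▸ .beta (t.subst (r.lift _)) (u.subst r)
  | fst_pair t u => exact .fst_pair _ _
  | snd_pair t u => exact .snd_pair _ _
  | primrec_zero t u => exact .primrec_zero _ _
  | primrec_succ t u n => exact .primrec_succ _ _ _

theorem Conv.app_wk_lam (t : Term (σ :: Γ) τ) :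
    Conv (.app ((Term.lam t).wk σ) (.var .zero)) t := by
  have beta := Conv.beta (t.subst ((Sub.shift σ).lift σ)) (.var .zero)
  have inst_eq : (t.subst ((Sub.shift σ).lift σ)).inst (.var .zero) = t := by
    simp [Term.inst, Sub.lift_eq_cons]
  rwa [inst_eq, ← Term.subst, ← Term.wk_eq_subst] at beta

theorem Conv.cond_zero (t u : Term Γ σ) : Conv (.cond .zero t u) t := .primrec_zero _ _

theorem Conv.cond_succ (n : Term Γ .nat) (t u : Term Γ σ) : Conv (.cond (.succ n) t u) u := by
  have apply_step : Conv (.app (.lam (.lam ((u.wk .nat).wk σ))) n) (.lam (u.wk σ)) := by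
    simpa [Term.inst, Term.wk_eq_subst, Sub.lift_eq_cons] using
      Conv.beta (.lam ((u.wk .nat).wk σ)) n
  have apply_const : Conv (.app (.lam (u.wk σ)) (.cond n t u)) u := by
    simpa using Conv.beta (u.wk σ) (.cond n t u)
  exact (Conv.primrec_succ _ _ _).trans ((Conv.app apply_step (.refl _)).trans apply_const)

end Substitution

/-! ### Derivability -/

theorem Hyps.get_wk {Γ : Ctx} (τ : Ty) {l : List Form} (Δ : Hyps Γ l) {a : Form} (i : Var l a) :
    (Δ.wk τ).get i = (Δ.get i).wk τ := by
  induction Δ with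
  | nil => cases i
  | cons A Δ ih =>
    cases i with
    | zero => rfl
    | succ i => exact ih i

/-- `A` is derivable in `S` from the open assumptions `Δ`: derivability as a proposition, for
arguments in which the derivation itself is irrelevant. -/
def Entails (S : Theory) {Γ : Ctx} {l : List Form} (Δ : Hyps Γ l) {a : Form} (A : Fm Γ a) : Prop :=
  Nonempty (Deriv S Δ A)

/-- Every assumption in `Δ` becomes, under the substitution `r`, an assumption in `Δ'`. -/
def Hyps.Maps {Γ Γ' : Ctx} {l l' : List Form} (Δ : Hyps Γ l) (r : Sub Γ Γ') (Δ' : Hyps Γ' l') :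
    Prop :=
  ∀ (a : Form) (i : Var l a), ∃ j : Var l' a, Δ'.get j = (Δ.get i).subst r

namespace Hyps.Maps

variable {Γ Γ' : Ctx} {l l' : List Form} {Δ : Hyps Γ l} {r : Sub Γ Γ'} {Δ' : Hyps Γ' l'} {a : Form}

theorem cons (h : Δ.Maps r Δ') (A : Fm Γ a) :
    (Hyps.cons A Δ).Maps r (Hyps.cons (A.subst r) Δ') := by
  intro b i
  cases i with
  | zero => exact ⟨.zero, rfl⟩
  | succ i =>
    obtain ⟨j, hj⟩ := h _ i
    exact ⟨.succ j, hj⟩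

theorem wk (h : Δ.Maps r Δ') (τ : Ty) : (Δ.wk τ).Maps (r.lift τ) (Δ'.wk τ) := by
  intro b i
  obtain ⟨j, hj⟩ := h _ i
  exact ⟨j, by rw [Hyps.get_wk, Hyps.get_wk, hj, Fm.subst_wk]⟩

theorem id_cons (Δ : Hyps Γ l) (A : Fm Γ a) : Δ.Maps (Sub.id Γ) (.cons A Δ) :=
  fun _ i => ⟨.succ i, (Fm.subst_id _).symm⟩

theorem shift (Δ : Hyps Γ l) (τ : Ty) : Δ.Maps (Sub.shift τ) (Δ.wk τ) :=
  fun _ i => ⟨i, Δ.get_wk τ i⟩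

end Hyps.Maps

namespace Entails

variable {S T : Theory} {Γ : Ctx} {l : List Form} {Δ : Hyps Γ l} {a b c : Form}
  {A : Fm Γ a} {B : Fm Γ b} {C : Fm Γ c} {σ : Ty}

theorem cast {A' : Fm Γ a} (h : Entails S Δ A) (e : A = A') : Entails S Δ A' := e ▸ h

theorem hyp (i : Var l a) : Entails S Δ (Δ.get i) := ⟨.hyp i⟩

theorem hyp₀ : Entails S (.cons A Δ) A := hyp (Δ := .cons A Δ) .zero

theorem hyp₁ : Entails S (.cons B (.cons A Δ)) A := hyp (Δ := .cons B (.cons A Δ)) (.succ .zero)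

theorem hyp₂ : Entails S (.cons C (.cons B (.cons A Δ))) A :=
  hyp (Δ := .cons C (.cons B (.cons A Δ))) (.succ (.succ .zero))

theorem andI (h : Entails S Δ A) (h' : Entails S Δ B) : Entails S Δ (.and A B) :=
  h.elim fun d => h'.elim fun d' => ⟨.andI d d'⟩

theorem andE1 (h : Entails S Δ (.and A B)) : Entails S Δ A := h.elim fun d => ⟨.andE1 d⟩

theorem andE2 (h : Entails S Δ (.and A B)) : Entails S Δ B := h.elim fun d => ⟨.andE2 d⟩

theorem orI1 (h : Entails S Δ A) : Entails S Δ (.or A B) := h.elim fun d => ⟨.orI1 d⟩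

theorem orI2 (h : Entails S Δ B) : Entails S Δ (.or A B) := h.elim fun d => ⟨.orI2 d⟩

theorem orE (h : Entails S Δ (.or A B)) (h₁ : Entails S (.cons A Δ) C)
    (h₂ : Entails S (.cons B Δ) C) : Entails S Δ C :=
  h.elim fun d => h₁.elim fun d₁ => h₂.elim fun d₂ => ⟨.orE d d₁ d₂⟩

theorem impI (h : Entails S (.cons A Δ) B) : Entails S Δ (.imp A B) := h.elim fun d => ⟨.impI d⟩

theorem impE (h : Entails S Δ (.imp A B)) (h' : Entails S Δ A) : Entails S Δ B :=
  h.elim fun d => h'.elim fun d' => ⟨.impE d d'⟩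

theorem allI {A : Fm (σ :: Γ) a} (h : Entails S (Δ.wk σ) A) : Entails S Δ (.all A) :=
  h.elim fun d => ⟨.allI d⟩

theorem allE {A : Fm (σ :: Γ) a} (t : Term Γ σ) (h : Entails S Δ (.all A)) :
    Entails S Δ (A.inst t) :=
  h.elim fun d => ⟨.allE t d⟩

theorem exI {A : Fm (σ :: Γ) a} (t : Term Γ σ) (h : Entails S Δ (A.inst t)) :
    Entails S Δ (.ex A) :=
  h.elim fun d => ⟨.exI t d⟩

theorem exE {A : Fm (σ :: Γ) a} (h : Entails S Δ (.ex A))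
    (h' : Entails S (.cons A (Δ.wk σ)) (C.wk σ)) : Entails S Δ C :=
  h.elim fun d => h'.elim fun d' => ⟨.exE d d'⟩

theorem botE (h : Entails S Δ .bot) : Entails S Δ A := h.elim fun d => ⟨.botE d⟩

theorem eqRefl (t : Term Γ .nat) : Entails S Δ (.eq t t) := ⟨.eqRefl t⟩

theorem eqSubst (A : Fm (.nat :: Γ) a) {t u : Term Γ .nat} (h : Entails S Δ (.eq t u))
    (h' : Entails S Δ (A.inst t)) : Entails S Δ (A.inst u) :=
  h.elim fun d => h'.elim fun d' => ⟨.eqSubst A d d'⟩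

theorem conv (A : Fm (σ :: Γ) a) {t u : Term Γ σ} (e : Conv t u) (h : Entails S Δ (A.inst t)) :
    Entails S Δ (A.inst u) :=
  h.elim fun d => ⟨.conv A e d⟩

theorem succNeZero {t : Term Γ .nat} (h : Entails S Δ (.eq (.succ t) .zero)) : Entails S Δ .bot :=
  h.elim fun d => ⟨.succNeZero d⟩

theorem succInj {t u : Term Γ .nat} (h : Entails S Δ (.eq (.succ t) (.succ u))) :
    Entails S Δ (.eq t u) :=
  h.elim fun d => ⟨.succInj d⟩

theorem ind {A : Fm (.nat :: Γ) a} (h : Entails S Δ (A.inst .zero))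
    (h' : Entails S Δ (.all (.imp A A.step))) : Entails S Δ (.all A) :=
  h.elim fun d => h'.elim fun d' => ⟨.ind d d'⟩

theorem lem (h : S.lem) (A : Fm Γ a) : Entails S Δ (.or A A.neg) := ⟨.lem h A⟩

theorem ac {ρ : Ty} (h : S.ac ρ σ) (A : Fm (σ :: ρ :: Γ) a) : Entails S Δ (acFm A) := ⟨.ac h A⟩

theorem dns (h : S.dns σ) (A : Fm (σ :: Γ) a) : Entails S Δ (dnsFm A) := ⟨.dns h A⟩

theorem subst (h : Entails S Δ A) {Γ' : Ctx} {l' : List Form} {r : Sub Γ Γ'} {Δ' : Hyps Γ' l'}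
    (hr : Δ.Maps r Δ') : Entails S Δ' (A.subst r) := by
  obtain ⟨d⟩ := h
  induction d generalizing Γ' l' with
  | hyp i =>
    obtain ⟨j, hj⟩ := hr _ i
    exact hj ▸ hyp j
  | andI _ _ ih ih' => exact andI (ih hr) (ih' hr)
  | andE1 _ ih => exact andE1 (ih hr)
  | andE2 _ ih => exact andE2 (ih hr)
  | orI1 _ ih => exact orI1 (ih hr)
  | orI2 _ ih => exact orI2 (ih hr)
  | orE _ _ _ ih ih₁ ih₂ => exact orE (ih hr) (ih₁ (hr.cons _)) (ih₂ (hr.cons _))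
  | impI _ ih => exact impI (ih (hr.cons _))
  | impE _ _ ih ih' => exact impE (ih hr) (ih' hr)
  | allI _ ih => exact allI (ih (hr.wk _))
  | allE t _ ih => exact (allE (t.subst r) (ih hr)).cast (Fm.inst_subst _ t r).symm
  | exI t _ ih => exact exI (t.subst r) ((ih hr).cast (Fm.inst_subst _ t r))
  | exE _ _ ih ih' => exact exE (ih hr) ((ih' ((hr.wk _).cons _)).cast (Fm.subst_wk _ _ r))
  | botE _ ih => exact botE (ih hr)
  | eqRefl t => exact eqRefl _
  | eqSubst A _ _ ih ih' =>
    simp only [Fm.inst_subst] at ih' ⊢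
    exact eqSubst _ (ih hr) (ih' hr)
  | conv A e _ ih =>
    simp only [Fm.inst_subst] at ih ⊢
    exact conv _ (e.subst r) (ih hr)
  | succNeZero _ ih => exact succNeZero (ih hr)
  | succInj _ ih => exact succInj (ih hr)
  | ind _ _ ih ih' =>
    simp only [Fm.inst_subst, Fm.subst, Fm.step_subst] at ih ih' ⊢
    exact ind (ih hr) (ih' hr)
  | lem h A => exact lem h _
  | ac h A => exact (ac h _).cast (acFm_subst A r).symm
  | dns h A => exact dns h _

theorem weaken (h : Entails S Δ A) : Entails S (.cons B Δ) A := by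
  simpa using h.subst (Hyps.Maps.id_cons Δ B)

theorem weaken₁ (h : Entails S (.cons B Δ) A) : Entails S (.cons B (.cons C Δ)) A := by
  simpa using h.subst ((Hyps.Maps.id_cons Δ C).cons B)

theorem wk (τ : Ty) (h : Entails S Δ A) : Entails S (Δ.wk τ) (A.wk τ) := h.subst (.shift Δ τ)

theorem wk_allE {Θ : Hyps (σ :: Γ) l} {A : Fm (σ :: Γ) a} (h : Entails S Θ ((Fm.all A).wk σ)) :
    Entails S Θ A :=
  (allE (.var .zero) h).cast A.subst_lift_shift_inst_var_zero

theorem allE_wk {A : Fm (σ :: Γ) a} (h : Entails S Δ (.all A)) : Entails S (Δ.wk σ) A :=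
  (h.wk σ).wk_allE

theorem exI_wk {Θ : Hyps (σ :: Γ) l} {A : Fm (σ :: Γ) a} (h : Entails S Θ A) :
    Entails S Θ ((Fm.ex A).wk σ) :=
  exI (.var .zero) (h.cast A.subst_lift_shift_inst_var_zero.symm)

theorem eq_of_conv {t u : Term Γ .nat} (e : Conv t u) : Entails S Δ (.eq t u) := by
  have inst_eq (v : Term Γ .nat) : (Fm.eq (t.wk .nat) (.var .zero)).inst v = .eq t v :=
    congrArg (Fm.eq · v) (t.wk_inst v)
  exact (conv _ e ((eqRefl t).cast (inst_eq t).symm)).cast (inst_eq u)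

theorem eq_symm {t u : Term Γ .nat} (h : Entails S Δ (.eq t u)) : Entails S Δ (.eq u t) := by
  have inst_eq (v : Term Γ .nat) : (Fm.eq (.var .zero) (t.wk .nat)).inst v = .eq v t :=
    congrArg (Fm.eq v) (t.wk_inst v)
  exact (eqSubst _ h ((eqRefl t).cast (inst_eq t).symm)).cast (inst_eq u)

theorem eq_trans {t u v : Term Γ .nat} (h : Entails S Δ (.eq t u)) (h' : Entails S Δ (.eq u v)) :
    Entails S Δ (.eq t v) := by
  have inst_eq (w : Term Γ .nat) : (Fm.eq (t.wk .nat) (.var .zero)).inst w = .eq t w :=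
    congrArg (Fm.eq · w) (t.wk_inst w)
  exact (eqSubst _ h' (h.cast (inst_eq u).symm)).cast (inst_eq v)

theorem neg_eq_zero_of_eq_succ {m n : Term Γ .nat} (h : Entails S Δ (.eq n (.succ m))) :
    Entails S Δ (Fm.eq n .zero).neg :=
  impI (succNeZero (h.eq_symm.weaken.eq_trans hyp₀))

theorem eq_zero_or_eq_succ (n : Term Γ .nat) :
    Entails S Δ (.or (.eq n .zero) (.ex (.eq (n.wk .nat) (.succ (.var .zero))))) := by
  let P : Fm (.nat :: Γ) _ :=
    .or (.eq (.var .zero) .zero) (.ex (.eq (.var (.succ .zero)) (.succ (.var .zero))))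
  have zero : Entails S Δ (P.inst .zero) := orI1 (eqRefl _)
  have succ : Entails S (.cons P (Δ.wk .nat)) P.step := orI2 (exI (.var .zero) (eqRefl _))
  exact allE n (ind zero (allI (impI succ)))

theorem neg_neg_intro (h : Entails S Δ A) : Entails S Δ A.neg.neg := impI (impE hyp₀ h.weaken)

theorem neg_neg_bind (h : Entails S Δ A.neg.neg) (h' : Entails S (.cons A Δ) B.neg.neg) :
    Entails S Δ B.neg.neg :=
  impI (impE h.weaken (impI (impE h'.weaken₁ hyp₁)))

theorem neg_neg_map (h : Entails S Δ A.neg.neg) (h' : Entails S (.cons A Δ) B) :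
    Entails S Δ B.neg.neg :=
  neg_neg_bind h (neg_neg_intro h')

theorem neg_neg_map₂ (h : Entails S Δ A.neg.neg) (h' : Entails S Δ B.neg.neg)
    (h'' : Entails S (.cons B (.cons A Δ)) C) : Entails S Δ C.neg.neg :=
  neg_neg_bind h (neg_neg_map h'.weaken h'')

theorem neg_neg_imp (h : Entails S (.cons A Δ) B.neg.neg) : Entails S Δ (Fm.imp A B).neg.neg :=
  impI (impE hyp₀ (impI (botE (impE h.weaken₁ (impI (impE hyp₂ (impI hyp₁)))))))

theorem neg_neg_all (hσ : S.dns σ) {A : Fm (σ :: Γ) a} (h : Entails S (Δ.wk σ) A.neg.neg) :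
    Entails S Δ (Fm.all A).neg.neg :=
  impE (dns hσ A) (allI h)

theorem neg_neg_em (A : Fm Γ a) : Entails S Δ (Fm.or A A.neg).neg.neg :=
  impI (impE hyp₀ (orI2 (impI (impE hyp₁ (orI1 hyp₀)))))

end Entails

/-! ### The negative translation -/

/-- The logical form of the negative translation of a formula. -/
@[reducible] def Form.negTrans : Form → Form
  | .prime => Form.prime.neg.neg
  | .and a b => .and a.negTrans b.negTrans
  | .or a b => (Form.or a.negTrans b.negTrans).neg.neg
  | .imp a b => .imp a.negTrans b.negTrans
  | .all σ a => .all σ a.negTrans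
  | .ex σ a => (Form.ex σ a.negTrans).neg.neg

/-- The negative translation of Gödel and Gentzen. As its logical form must not depend on which
prime formula is translated, falsity is doubly negated as well. -/
def Fm.negTrans {Γ : Ctx} {a : Form} : Fm Γ a → Fm Γ a.negTrans
  | .eq t u => (Fm.eq t u).neg.neg
  | .bot => Fm.bot.neg.neg
  | .and A B => .and A.negTrans B.negTrans
  | .or A B => (Fm.or A.negTrans B.negTrans).neg.neg
  | .imp A B => .imp A.negTrans B.negTrans
  | .all A => .all A.negTrans
  | .ex A => (Fm.ex A.negTrans).neg.neg

/-- The negative translation of all formulas in a list of assumptions. -/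
def Hyps.negTrans {Γ : Ctx} : {l : List Form} → Hyps Γ l → Hyps Γ (l.map Form.negTrans)
  | _, .nil => .nil
  | _, .cons A Δ => .cons A.negTrans Δ.negTrans

theorem Fm.negTrans_subst {Γ Γ' : Ctx} {a : Form} (A : Fm Γ a) (r : Sub Γ Γ') :
    (A.subst r).negTrans = A.negTrans.subst r := by
  induction A generalizing Γ' with
  | _ => simp only [Fm.subst, Fm.negTrans, *]

theorem Fm.negTrans_inst {Γ : Ctx} {τ : Ty} {a : Form} (A : Fm (τ :: Γ) a) (t : Term Γ τ) :
    (A.inst t).negTrans = A.negTrans.inst t :=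
  A.negTrans_subst _

theorem Fm.negTrans_wk {Γ : Ctx} (τ : Ty) {a : Form} (A : Fm Γ a) :
    (A.wk τ).negTrans = A.negTrans.wk τ :=
  A.negTrans_subst _

theorem Fm.negTrans_step {Γ : Ctx} {a : Form} (A : Fm (.nat :: Γ) a) :
    A.step.negTrans = A.negTrans.step :=
  A.negTrans_subst _

theorem Hyps.negTrans_wk {Γ : Ctx} (τ : Ty) {l : List Form} (Δ : Hyps Γ l) :
    (Δ.wk τ).negTrans = Δ.negTrans.wk τ := by
  induction Δ with
  | nil => rfl
  | cons A Δ ih => simp only [Hyps.wk, Hyps.negTrans, Fm.negTrans_wk, ih]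

namespace Entails

variable {S T : Theory} {Γ : Ctx} {l : List Form} {Δ : Hyps Γ l} {a : Form} {A : Fm Γ a} {σ : Ty}

theorem negTrans_hyp (i : Var l a) : Entails S Δ.negTrans (Δ.get i).negTrans := by
  induction Δ with
  | nil => cases i
  | cons A Δ ih =>
    cases i with
    | zero => exact hyp₀
    | succ i => exact (ih i).weaken

theorem negTrans_stable (h : Entails S Δ A.negTrans.neg.neg) : Entails S Δ A.negTrans := by
  induction A generalizing l with
  | eq | bot | or | ex => exact neg_neg_bind h hyp₀
  | and _ _ ihA ihB => exact andI (ihA (neg_neg_map h hyp₀.andE1)) (ihB (neg_neg_map h hyp₀.andE2))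
  | imp _ _ _ ihB => exact impI (ihB (neg_neg_map h.weaken (impE hyp₀ hyp₁)))
  | all _ ih => exact allI (ih (neg_neg_map (h.wk _) hyp₀.wk_allE))

theorem negTrans_of_neg_neg_map {b : Form} {B : Fm Γ b} (h : Entails S Δ B.neg.neg)
    (h' : Entails S (.cons B Δ) A.negTrans) : Entails S Δ A.negTrans :=
  negTrans_stable (neg_neg_map h h')

theorem negTrans_of_negTrans_neg_neg (h : Entails S Δ A.neg.neg.negTrans) :
    Entails S Δ A.negTrans := by
  have negTrans_bot_of_bot {l : List Form} {Δ : Hyps Γ l} (h : Entails S Δ .bot) :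
      Entails S Δ Fm.bot.negTrans := neg_neg_intro h
  have bot_of_negTrans_bot {l : List Form} {Δ : Hyps Γ l} (h : Entails S Δ Fm.bot.negTrans) :
      Entails S Δ .bot := impE h (impI hyp₀)
  exact negTrans_stable (impI (bot_of_negTrans_bot
    (impE h.weaken (impI (negTrans_bot_of_bot (impE hyp₁ hyp₀))))))

theorem negTrans_dnsFm (A : Fm (σ :: Γ) a) : Entails S Δ (dnsFm A).negTrans := by
  have negTrans_all : Entails S (.cons (Fm.all A.neg.neg).negTrans Δ) (Fm.all A).negTrans :=
    allI (negTrans_of_negTrans_neg_neg (wk_allE hyp₀))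
  exact impI (impI (impE hyp₀ negTrans_all.weaken))

theorem negTrans_acFm {ρ : Ty} (hac : S.ac ρ σ) (hdns : S.dns ρ) (A : Fm (σ :: ρ :: Γ) a) :
    Entails S Δ (acFm A).negTrans := by
  have choice : Entails S (.cons (.all (.ex A.negTrans)) (.cons (Fm.all (.ex A)).negTrans Δ))
      (.ex (Fm.all (A.subst (choiceSub Γ ρ σ))).negTrans) := by
    simp only [Fm.negTrans, Fm.negTrans_subst]
    exact impE (ac hac A.negTrans) hyp₀
  exact impI (neg_neg_map (neg_neg_all hdns (wk_allE hyp₀)) choice)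

theorem negTrans (hac : ∀ ρ σ, T.ac ρ σ → S.ac ρ σ) (hdns : ∀ ρ σ, T.ac ρ σ → S.dns ρ)
    (h : Entails T Δ A) : Entails S Δ.negTrans A.negTrans := by
  obtain ⟨d⟩ := h
  induction d with
  | hyp i => exact negTrans_hyp i
  | andI _ _ ih ih' => exact andI ih ih'
  | andE1 _ ih => exact andE1 ih
  | andE2 _ ih => exact andE2 ih
  | orI1 _ ih => exact neg_neg_intro (orI1 ih)
  | orI2 _ ih => exact neg_neg_intro (orI2 ih)
  | orE _ _ _ ih ih₁ ih₂ =>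
    exact negTrans_of_neg_neg_map ih (orE hyp₀ ih₁.weaken₁ ih₂.weaken₁)
  | impI _ ih => exact impI ih
  | impE _ _ ih ih' => exact impE ih ih'
  | allI _ ih => exact allI (Hyps.negTrans_wk _ _ ▸ ih)
  | allE t _ ih => exact (allE t ih).cast (Fm.negTrans_inst _ t).symm
  | exI t _ ih => exact neg_neg_intro (exI t (ih.cast (Fm.negTrans_inst _ t)))
  | exE _ _ ih ih' =>
    simp only [Hyps.negTrans, Hyps.negTrans_wk, Fm.negTrans_wk] at ih'
    exact negTrans_of_neg_neg_map ih (exE hyp₀ ih'.weaken₁)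
  | botE _ ih => exact negTrans_of_neg_neg_map ih (botE hyp₀)
  | eqRefl t => exact neg_neg_intro (eqRefl t)
  | eqSubst A _ _ ih ih' =>
    refine negTrans_of_neg_neg_map ih ?_
    rw [Fm.negTrans_inst] at ih' ⊢
    exact eqSubst _ hyp₀ ih'.weaken
  | conv A e _ ih =>
    rw [Fm.negTrans_inst] at ih ⊢
    exact conv _ e ih
  | succNeZero _ ih => exact neg_neg_map ih (succNeZero hyp₀)
  | succInj _ ih => exact neg_neg_map ih (succInj hyp₀)
  | ind _ _ ih ih' =>
    simp only [Fm.negTrans, Fm.negTrans_inst, Fm.negTrans_step] at ih ih'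
    exact ind ih ih'
  | lem _ A =>
    exact neg_neg_map (neg_neg_em A.negTrans)
      (orE hyp₀ (orI1 hyp₀) (orI2 (impI (neg_neg_intro (impE hyp₁ hyp₀)))))
  | ac h A => exact negTrans_acFm (hac _ _ h) (hdns _ _ h) A
  | dns _ A => exact negTrans_dnsFm A

end Entails

mutual

/-- Every universal quantifier in positive position ranges over a type in `P`. At these types the
double-negation shift is needed to turn a negative translation into a double negation. -/
def Form.PosForallIn (P : Ty → Prop) : Form → Prop
  | .prime => True
  | .and a b => a.PosForallIn P ∧ b.PosForallIn P
  | .or a b => a.PosForallIn P ∧ b.PosForallIn P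
  | .imp a b => a.NegForallIn P ∧ b.PosForallIn P
  | .all σ a => P σ ∧ a.PosForallIn P
  | .ex _ a => a.PosForallIn P

/-- Every universal quantifier in negative position ranges over a type in `P`: the dual notion
to `Form.PosForallIn`, needed for the premises of implications. -/
def Form.NegForallIn (P : Ty → Prop) : Form → Prop
  | .prime => True
  | .and a b => a.NegForallIn P ∧ b.NegForallIn P
  | .or a b => a.NegForallIn P ∧ b.NegForallIn P
  | .imp a b => a.PosForallIn P ∧ b.NegForallIn P
  | .all _ a => a.NegForallIn P
  | .ex _ a => a.NegForallIn P

end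

theorem Form.forallIn_of_forall {P : Ty → Prop} (hP : ∀ σ, P σ) (a : Form) :
    a.PosForallIn P ∧ a.NegForallIn P := by
  induction a with
  | _ => simp_all only [Form.PosForallIn, Form.NegForallIn, and_self]

theorem Form.Arithmetical.forallIn {a : Form} (ha : a.Arithmetical) :
    a.PosForallIn (· = .nat) ∧ a.NegForallIn (· = .nat) := by
  induction a with
  | _ => simp_all only [Form.Arithmetical, Form.PosForallIn, Form.NegForallIn, and_self]

namespace Entails

variable {S : Theory}

mutual

theorem neg_neg_of_negTrans {Γ : Ctx} {l : List Form} {Δ : Hyps Γ l} {a : Form} {A : Fm Γ a}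
    (ha : a.PosForallIn S.dns) (h : Entails S Δ A.negTrans) : Entails S Δ A.neg.neg :=
  match A, ha, h with
  | .eq _ _, _, h | .bot, _, h => h
  | .and _ _, ⟨ha, hb⟩, h =>
    neg_neg_map₂ (neg_neg_of_negTrans ha h.andE1) (neg_neg_of_negTrans hb h.andE2)
      (andI hyp₁ hyp₀)
  | .or _ _, ⟨ha, hb⟩, h =>
    neg_neg_bind h (orE hyp₀ (neg_neg_map (neg_neg_of_negTrans ha hyp₀) (orI1 hyp₀))
      (neg_neg_map (neg_neg_of_negTrans hb hyp₀) (orI2 hyp₀)))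
  | .imp _ _, ⟨ha, hb⟩, h =>
    neg_neg_imp (neg_neg_of_negTrans hb (impE h.weaken (negTrans_of_negForallIn ha hyp₀)))
  | .all _, ⟨hσ, ha⟩, h => neg_neg_all hσ (neg_neg_of_negTrans ha h.allE_wk)
  | .ex A, ha, h =>
    neg_neg_bind h (exE hyp₀ (neg_neg_map (neg_neg_of_negTrans (A := A) ha hyp₀) (exI_wk hyp₀)))

theorem negTrans_of_negForallIn {Γ : Ctx} {l : List Form} {Δ : Hyps Γ l} {a : Form} {A : Fm Γ a}
    (ha : a.NegForallIn S.dns) (h : Entails S Δ A) : Entails S Δ A.negTrans :=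
  match A, ha, h with
  | .eq _ _, _, h | .bot, _, h => neg_neg_intro h
  | .and _ _, ⟨ha, hb⟩, h =>
    andI (negTrans_of_negForallIn ha h.andE1) (negTrans_of_negForallIn hb h.andE2)
  | .or _ _, ⟨ha, hb⟩, h =>
    neg_neg_intro (orE h (orI1 (negTrans_of_negForallIn ha hyp₀))
      (orI2 (negTrans_of_negForallIn hb hyp₀)))
  | .imp _ _, ⟨ha, hb⟩, h =>
    impI (negTrans_of_neg_neg_map (neg_neg_of_negTrans ha hyp₀)
      (negTrans_of_negForallIn hb (impE h.weaken.weaken hyp₀)))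
  | .all _, ha, h => allI (negTrans_of_negForallIn ha h.allE_wk)
  | .ex _, ha, h => neg_neg_intro (exE h (exI_wk (negTrans_of_negForallIn ha hyp₀)))

end

end Entails

/-! ### Soundness of modified realizability -/

section Substitution

variable {Γ Γ' : Ctx} {a : Form} {σ : Ty}

@[simp]
theorem mr_subst (t : Term Γ a.rty) (A : Fm Γ a) (r : Sub Γ Γ') :
    (mr t A).subst r = mr (t.subst r) (A.subst r) := by
  induction a generalizing Γ Γ' with
  | prime => rfl
  | and a b iha ihb =>
    cases A
    simp only [mr, Fm.subst, iha, ihb, Term.subst]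
  | or a b iha ihb =>
    cases A
    simp only [mr, Fm.subst, iha, ihb, Term.subst]
  | imp a b iha ihb =>
    cases A
    simp only [mr, Fm.subst, iha, ihb, Term.subst, Fm.subst_wk, Term.subst_wk]
    rfl
  | all σ a iha =>
    cases A
    simp only [mr, Fm.subst, iha, Term.subst, Term.subst_wk]
    rfl
  | ex σ a iha =>
    cases A
    simp only [mr, Fm.subst, iha, Term.subst, Fm.inst_subst]

theorem mr_inst (t : Term (σ :: Γ) a.rty) (A : Fm (σ :: Γ) a) (u : Term Γ σ) :
    (mr t A).inst u = mr (t.inst u) (A.inst u) :=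
  mr_subst t A _

theorem mr_wk (t : Term Γ a.rty) (A : Fm Γ a) (σ : Ty) :
    (mr t A).wk σ = mr (t.wk σ) (A.wk σ) := by
  rw [Fm.wk, mr_subst, Term.wk_eq_subst, Fm.wk, Sub.wk_id]

theorem mr_wk_inst (t : Term Γ a.rty) (A : Fm (σ :: Γ) a) (u : Term Γ σ) :
    (mr (t.wk σ) A).inst u = mr t (A.inst u) := by
  rw [mr_inst, Term.wk_inst]

theorem mr_var_zero_inst (t : Term Γ a.rty) (A : Fm Γ a) :
    (mr (.var .zero) (A.wk a.rty)).inst t = mr t A := by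
  rw [mr_inst, Fm.wk_inst]
  rfl

end Substitution

namespace Entails

variable {S : Theory} {Γ : Ctx} {l : List Form} {Δ : Hyps Γ l} {a b : Form}
  {A : Fm Γ a} {B : Fm Γ b} {σ : Ty}

theorem mr_cast {A' : Fm Γ a} {t : Term Γ a.rty} (h : Entails S Δ (mr t A)) (e : A = A') :
    Entails S Δ (mr t A') :=
  e ▸ h

theorem mr_conv {t u : Term Γ a.rty} (e : Conv t u) (h : Entails S Δ (mr t A)) :
    Entails S Δ (mr u A) :=
  (conv _ e (h.cast (mr_var_zero_inst t A).symm)).cast (mr_var_zero_inst u A)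

theorem mr_conv_inst {A : Fm (σ :: Γ) a} {t : Term Γ a.rty} {u v : Term Γ σ} (e : Conv u v)
    (h : Entails S Δ (mr t (A.inst u))) : Entails S Δ (mr t (A.inst v)) :=
  (conv _ e (h.cast (mr_wk_inst t A u).symm)).cast (mr_wk_inst t A v)

theorem mr_eqSubst {A : Fm (.nat :: Γ) a} {t : Term Γ a.rty} {u v : Term Γ .nat}
    (e : Entails S Δ (.eq u v)) (h : Entails S Δ (mr t (A.inst u))) :
    Entails S Δ (mr t (A.inst v)) :=
  (eqSubst _ e (h.cast (mr_wk_inst t A u).symm)).cast (mr_wk_inst t A v)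

theorem mr_andI {t : Term Γ a.rty} {u : Term Γ b.rty} (h : Entails S Δ (mr t A))
    (h' : Entails S Δ (mr u B)) : Entails S Δ (mr (a := .and a b) (.pair t u) (.and A B)) :=
  andI (mr_conv (Conv.fst_pair t u).symm h) (mr_conv (Conv.snd_pair t u).symm h')

theorem mr_impI {t : Term (a.rty :: Γ) b.rty}
    (h : Entails S (.cons (mr (.var .zero) (A.wk a.rty)) (Δ.wk a.rty)) (mr t (B.wk a.rty))) :
    Entails S Δ (mr (a := .imp a b) (.lam t) (.imp A B)) :=
  allI (impI (mr_conv (Conv.app_wk_lam t).symm h))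

theorem mr_impE {t : Term Γ (Form.imp a b).rty} {u : Term Γ a.rty}
    (h : Entails S Δ (mr (a := .imp a b) t (.imp A B))) (h' : Entails S Δ (mr u A)) :
    Entails S Δ (mr (a := b) (.app t u) B) := by
  have app_inst : (mr (a := b) (.app (t.wk a.rty) (.var .zero)) (B.wk a.rty)).inst u =
      mr (a := b) (.app t u) B := by
    rw [mr_inst, Fm.wk_inst]
    exact congrArg (fun t' => mr (a := b) (.app t' u) B) (t.wk_inst u)
  exact (impE (allE u h) (h'.cast (mr_var_zero_inst u A).symm)).cast app_inst

theorem mr_allI {A : Fm (σ :: Γ) a} {t : Term (σ :: Γ) a.rty} (h : Entails S (Δ.wk σ) (mr t A)) :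
    Entails S Δ (mr (a := .all σ a) (.lam t) (.all A)) :=
  allI (mr_conv (Conv.app_wk_lam t).symm h)

theorem mr_allE {A : Fm (σ :: Γ) a} {t : Term Γ (Form.all σ a).rty} (u : Term Γ σ)
    (h : Entails S Δ (mr (a := .all σ a) t (.all A))) :
    Entails S Δ (mr (a := a) (.app t u) (A.inst u)) := by
  have app_inst : (mr (a := a) (.app (t.wk σ) (.var .zero)) A).inst u =
      mr (a := a) (.app t u) (A.inst u) := by
    rw [mr_inst]
    exact congrArg (fun t' => mr (a := a) (.app t' u) (A.inst u)) (t.wk_inst u)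
  exact (allE u h).cast app_inst

theorem mr_exI {A : Fm (σ :: Γ) a} {t : Term Γ a.rty} {u : Term Γ σ}
    (h : Entails S Δ (mr t (A.inst u))) :
    Entails S Δ (mr (a := .ex σ a) (.pair t u) (.ex A)) :=
  mr_conv (a := a) (Conv.fst_pair t u).symm (mr_conv_inst (Conv.snd_pair t u).symm h)

theorem mr_orI1 {t : Term Γ a.rty} (u : Term Γ b.rty) (h : Entails S Δ (mr t A)) :
    Entails S Δ (mr (a := .or a b) (.pair (.pair t u) .zero) (.or A B)) :=
  andI (impI (mr_conv ((Conv.fst (.fst_pair _ _)).trans (.fst_pair _ _)).symm h.weaken))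
    (impI (botE (impE hyp₀ (eq_of_conv (.snd_pair _ _)))))

theorem mr_orI2 (t : Term Γ a.rty) {u : Term Γ b.rty} (h : Entails S Δ (mr u B)) :
    Entails S Δ (mr (a := .or a b) (.pair (.pair t u) (.succ .zero)) (.or A B)) :=
  andI (impI (botE (succNeZero ((eq_of_conv (Conv.snd_pair _ _).symm).eq_trans hyp₀))))
    (impI (mr_conv ((Conv.snd (.fst_pair _ _)).trans (.snd_pair _ _)).symm h.weaken))

theorem mr_cond_of_eq {m n : Term Γ .nat} {t u : Term Γ a.rty} (e : Entails S Δ (.eq m n))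
    (h : Entails S Δ (mr (.cond m t u) A)) : Entails S Δ (mr (.cond n t u) A) := by
  have cond_inst (k : Term Γ .nat) :
      (mr (.cond (.var .zero) (t.wk .nat) (u.wk .nat)) (A.wk .nat)).inst k =
        mr (.cond k t u) A := by
    simp [mr_inst, Term.inst, Term.cond_subst, Term.wk_eq_subst]
  exact (eqSubst _ e (h.cast (cond_inst m).symm)).cast (cond_inst n)

theorem mr_cond_of_eq_zero {n : Term Γ .nat} {t : Term Γ a.rty} (u : Term Γ a.rty)
    (hn : Entails S Δ (.eq n .zero)) (h : Entails S Δ (mr t A)) :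
    Entails S Δ (mr (.cond n t u) A) :=
  mr_cond_of_eq hn.eq_symm (mr_conv (Conv.cond_zero t u).symm h)

theorem mr_cond_of_eq_succ {m n : Term Γ .nat} (t : Term Γ a.rty) {u : Term Γ a.rty}
    (hn : Entails S Δ (.eq n (.succ m))) (h : Entails S Δ (mr u A)) :
    Entails S Δ (mr (.cond n t u) A) :=
  mr_cond_of_eq hn.eq_symm (mr_conv (Conv.cond_succ m t u).symm h)

theorem mr_cond {n : Term Γ .nat} {t u : Term Γ a.rty}
    (h : Entails S Δ (.imp (.eq n .zero) (mr t A)))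
    (h' : Entails S Δ (.imp (Fm.neg (.eq n .zero)) (mr u A))) :
    Entails S Δ (mr (.cond n t u) A) := by
  refine orE (eq_zero_or_eq_succ n) ?zero (exE hyp₀ ?succ)
  case zero => exact mr_cond_of_eq_zero u hyp₀ (impE h.weaken hyp₀)
  case succ =>
    have cond_wk : (mr (.cond n t u) A).wk .nat =
        mr (.cond (n.wk .nat) (t.wk .nat) (u.wk .nat)) (A.wk .nat) := by
      simp only [mr_wk, Term.wk_eq_subst, Term.cond_subst]
    have imp_wk : (Fm.imp (Fm.neg (.eq n .zero)) (mr u A)).wk .nat =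
        .imp (Fm.neg (.eq (n.wk .nat) .zero)) (mr (u.wk .nat) (A.wk .nat)) := by
      rw [← mr_wk, Term.wk_eq_subst]
      rfl
    rw [cond_wk]
    exact mr_cond_of_eq_succ _ hyp₀
      (impE ((h'.wk .nat).cast imp_wk).weaken.weaken (neg_eq_zero_of_eq_succ hyp₀))

theorem mr_ind {A : Fm (.nat :: Γ) a} {t : Term Γ a.rty}
    {u : Term Γ (.arr .nat (.arr a.rty a.rty))} (h : Entails S Δ (mr t (A.inst .zero)))
    (h' : Entails S Δ (mr (a := .all .nat (.imp a a)) u (.all (.imp A A.step)))) :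
    Entails S Δ (mr (a := .all .nat a)
      (.lam (.primrec (t.wk .nat) (u.wk .nat) (.var .zero))) (.all A)) := by
  let F := mr (.primrec (t.wk .nat) (u.wk .nat) (.var .zero)) A
  have inst_zero : F.inst .zero = mr (.primrec t u .zero) (A.inst .zero) := by
    simp [F, Fm.inst, Term.wk_eq_subst]
  have step : F.step = mr (.primrec (t.wk .nat) (u.wk .nat) (.succ (.var .zero))) A.step := by
    simp [F, Fm.step, Term.wk_eq_subst]
  have base : Entails S Δ (F.inst .zero) :=
    (mr_conv (Conv.primrec_zero t u).symm h).cast inst_zero.symm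
  have next : Entails S (.cons F (Δ.wk .nat)) F.step :=
    (mr_conv (Conv.primrec_succ _ _ _).symm (mr_impE h'.allE_wk.weaken hyp₀)).cast step.symm
  exact mr_allI (allE_wk (ind base (allI (impI next))))

theorem mr_acFm {ρ : Ty} (A : Fm (σ :: ρ :: Γ) a) :
    Entails S Δ (mr (a := .imp (.all ρ (.ex σ a)) (.ex (.arr ρ σ) (.all ρ a)))
      (.lam (.pair (.lam (.fst (.app (.var (.succ .zero)) (.var .zero))))
        (.lam (.snd (.app (.var (.succ .zero)) (.var .zero)))))) (acFm A)) := by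
  refine mr_impI (A := .all (.ex A)) (B := .ex (.all (A.subst (choiceSub Γ ρ σ))))
    (mr_exI (A := (Fm.all (A.subst (choiceSub Γ ρ σ))).subst ((Sub.shift _).lift _))
      (mr_allI ?_))
  let B : Fm (σ :: ρ :: (Form.all ρ (.ex σ a)).rty :: Γ) a :=
    A.subst (((Sub.shift _).lift ρ).lift σ)
  have pointwise := allE_wk (hyp₀ (S := S)
    (A := mr (.var .zero) ((Fm.all (.ex A)).wk (Form.all ρ (.ex σ a)).rty)) (Δ := Δ.wk _))
  have snd_eq : Conv _ _ := (Conv.app_wk_lam (Γ := (Form.all ρ (.ex σ a)).rty :: Γ) (σ := ρ)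
    (.snd (.app (.var (.succ .zero)) (.var .zero)))).symm
  refine mr_cast (mr_conv_inst (A := B) snd_eq pointwise) ?_
  simp [B, choiceSub_eq_cons, Fm.inst, Sub.id, Sub.lift_eq_cons, Term.wk_eq_subst]

theorem bot_of_mr_all_neg_neg {A : Fm (σ :: Γ) a} (hσ : S.dns σ) (hac : S.ac σ a.rty)
    {t : Term Γ (Form.all σ a.neg.neg).rty} {u : Term Γ (Form.all σ a).neg.rty}
    (ht : Entails S Δ (mr (a := .all σ a.neg.neg) t (.all A.neg.neg)))
    (hu : Entails S Δ (mr (a := (Form.all σ a).neg) u (Fm.all A).neg)) :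
    Entails S Δ .bot := by
  have pointwise : Entails S (Δ.wk σ) (Fm.ex (mr (.var .zero) (A.wk a.rty))).neg.neg :=
    impI (mr_impE (B := .bot) ht.allE_wk.weaken
      (mr_impI (t := .star) (B := .bot) (impE hyp₁ (exI_wk hyp₀))))
  have uniform := neg_neg_all hσ pointwise
  refine impE uniform (impI (exE (impE (ac hac _) hyp₀) ?_))
  have refutes : Entails S (Δ.wk (.arr σ a.rty)) (mr _ ((Fm.all A).neg.wk _)) :=
    (hu.wk (.arr σ a.rty)).cast (mr_wk (a := (Form.all σ a).neg) u _ _)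
  refine mr_impE (A := (Fm.all A).wk _) (B := .bot) (u := .var .zero) refutes.weaken.weaken
    (hyp₀.cast (congrArg Fm.all ?_))
  rw [mr_subst, choiceSub_eq_cons, Fm.subst_cons_wk, Sub.lift_eq_cons]
  rfl

theorem mr_dnsFm (hσ : S.dns σ) (A : Fm (σ :: Γ) a) (hac : S.ac σ a.rty) :
    Entails S Δ (mr (a := .imp (.all σ a.neg.neg) (Form.all σ a).neg.neg)
      (Term.dflt _) (dnsFm A)) := by
  refine mr_impI (A := .all A.neg.neg) (B := (Fm.all A).neg.neg) (t := .lam .star)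
    (mr_impI (A := (Fm.all A).neg.wk _) (B := .bot) (t := .star) ?_)
  exact bot_of_mr_all_neg_neg hσ hac (hyp₁.cast (mr_wk _ _ _)) hyp₀

end Entails

/-- The terms `e` realize, provably in `S` from the assumptions `Ξ`, the instances of the
assumptions `Δ` under the substitution `r`. -/
def Realizers.Realize (S : Theory) {Γ Γ' : Ctx} {l l' : List Form} (e : Realizers Γ' l)
    (Δ : Hyps Γ l) (r : Sub Γ Γ') (Ξ : Hyps Γ' l') : Prop :=
  ∀ (a : Form) (i : Var l a), Entails S Ξ (mr (e a i) ((Δ.get i).subst r))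

namespace Realizers.Realize

variable {S : Theory} {Γ Γ' : Ctx} {l l' : List Form} {e : Realizers Γ' l} {Δ : Hyps Γ l}
  {r : Sub Γ Γ'} {Ξ : Hyps Γ' l'} {a : Form} {τ : Ty}

theorem nil (r : Sub Γ Γ') (Ξ : Hyps Γ' l') : Realizers.nil.Realize S .nil r Ξ :=
  fun _ i => nomatch i

theorem cons (h : e.Realize S Δ r Ξ) {A : Fm Γ a} {t : Term Γ' a.rty}
    (ht : Entails S Ξ (mr t (A.subst r))) : (e.cons t).Realize S (.cons A Δ) r Ξ := by
  intro b i
  cases i with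
  | zero => exact ht
  | succ i => exact h b i

theorem weaken (h : e.Realize S Δ r Ξ) (B : Fm Γ' a) : e.Realize S Δ r (.cons B Ξ) :=
  fun b i => (h b i).weaken

theorem wk (h : e.Realize S Δ r Ξ) (τ : Ty) : (e.wk τ).Realize S Δ (r.wk τ) (Ξ.wk τ) := by
  intro a i
  rw [Fm.subst_sub_wk]
  exact ((h a i).wk τ).cast (mr_wk _ _ τ)

theorem hyps_wk (h : e.Realize S Δ r Ξ) (t : Term Γ' τ) :
    e.Realize S (Δ.wk τ) (Sub.cons t r) Ξ := by
  intro a i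
  rw [Hyps.get_wk, Fm.subst_cons_wk]
  exact h a i

theorem cons_var_zero (h : e.Realize S Δ r Ξ) (A : Fm Γ a) :
    ((e.wk a.rty).cons (.var .zero)).Realize S (.cons A Δ) (r.wk a.rty)
      (.cons (mr (.var .zero) ((A.subst r).wk a.rty)) (Ξ.wk a.rty)) :=
  ((h.wk _).weaken _).cons (Entails.hyp₀.mr_cast (A.subst_sub_wk _ r).symm)

end Realizers.Realize

namespace Entails

variable {S : Theory} {Γ Γ' : Ctx} {l l' : List Form} {Δ : Hyps Γ l} {a : Form} {A : Fm Γ a}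

theorem mr_extractAux (hS : ¬ S.lem) (hac : ∀ ρ σ, S.dns ρ → S.ac ρ σ) (d : Deriv S Δ A)
    {r : Sub Γ Γ'} {e : Realizers Γ' l} {Ξ : Hyps Γ' l'} (he : e.Realize S Δ r Ξ) :
    Entails S Ξ (mr (d.extractAux hS r e) (A.subst r)) := by
  induction d generalizing Γ' l' with
  | hyp i => exact he _ i
  | andI _ _ ih ih' => exact mr_andI (ih he) (ih' he)
  | andE1 _ ih => exact andE1 (ih he)
  | andE2 _ ih => exact andE2 (ih he)
  | orI1 _ ih => exact mr_orI1 _ (ih he)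
  | orI2 _ ih => exact mr_orI2 _ (ih he)
  | orE _ _ _ ih ih₁ ih₂ =>
    have left_of_zero := andE1 (ih he)
    have right_of_ne_zero := andE2 (ih he)
    exact mr_cond (impI (ih₁ ((he.weaken _).cons (impE left_of_zero.weaken hyp₀))))
      (impI (ih₂ ((he.weaken _).cons (impE right_of_ne_zero.weaken hyp₀))))
  | impI _ ih => exact mr_impI ((ih (he.cons_var_zero _)).mr_cast (Fm.subst_sub_wk _ _ r))
  | impE _ _ ih ih' => exact mr_impE (ih he) (ih' he)
  | allI _ ih => exact mr_allI (ih ((he.wk _).hyps_wk _))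
  | allE t _ ih => exact (mr_allE (t.subst r) (ih he)).mr_cast (Fm.inst_subst _ t r).symm
  | exI t _ ih => exact mr_exI ((ih he).mr_cast (Fm.inst_subst _ t r))
  | @exE _ _ _ _ _ _ A _ d _ ih ih' =>
    have witness : Entails S Ξ (mr (.fst (d.extractAux hS r e))
        (A.subst (Sub.cons (.snd (d.extractAux hS r e)) r))) := by
      rw [← Fm.subst_lift_inst]
      exact ih he
    exact (ih' ((he.hyps_wk _).cons witness)).mr_cast (Fm.subst_cons_wk _ _ r)
  | botE _ ih => exact botE (ih he)
  | eqRefl t => exact eqRefl _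
  | eqSubst A _ _ ih ih' =>
    simp only [Fm.inst_subst] at ih' ⊢
    exact mr_eqSubst (ih he) (ih' he)
  | conv A c _ ih =>
    simp only [Fm.inst_subst] at ih ⊢
    exact mr_conv_inst (c.subst r) (ih he)
  | succNeZero _ ih => exact succNeZero (ih he)
  | succInj _ ih => exact succInj (ih he)
  | ind _ _ ih ih' =>
    have base := (ih he).mr_cast (Fm.inst_subst _ .zero r)
    have step := (ih' he).mr_cast (congrArg (fun B => Fm.all (.imp _ B)) (Fm.step_subst _ r))
    exact mr_ind base step
  | lem h _ => exact absurd h hS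
  | ac _ A => exact (mr_acFm _).mr_cast (acFm_subst A r).symm
  | dns h A => exact mr_dnsFm h (A.subst (r.lift _)) (hac _ _ h)

end Entails

theorem Provable.mr_extract {S : Theory} (hS : ¬ S.lem) (hac : ∀ ρ σ, S.dns ρ → S.ac ρ σ)
    {Γ : Ctx} {a : Form} {A : Fm Γ a} (d : Proof S A) : Provable S (mr (d.extract hS) A) :=
  (Entails.mr_extractAux hS hac d (.nil (Sub.id Γ) .nil)).mr_cast A.subst_id

theorem Provable.neg_neg_of_classical {S T : Theory} (hac : ∀ ρ σ, T.ac ρ σ → S.ac ρ σ)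
    (hdns : ∀ ρ σ, T.ac ρ σ → S.dns ρ) {Γ : Ctx} {a : Form} {A : Fm Γ a}
    (ha : a.PosForallIn S.dns) (h : Provable T A) : Provable S A.neg.neg :=
  Entails.neg_neg_of_negTrans ha (Entails.negTrans hac hdns h)

end HAOmega

open HAOmega in
theorem mainTheorem2_general {S T : Theory} (hS : ¬ S.lem) (hac : ∀ ρ σ, T.ac ρ σ → S.ac ρ σ)
    (hdns : ∀ ρ σ, T.ac ρ σ → S.dns ρ) (hSac : ∀ ρ σ, S.dns ρ → S.ac ρ σ) {Γ : Ctx} {a : Form}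
    (A : Fm Γ a) (ha : a.PosForallIn S.dns) (h : Provable T A) :
    Provable S A.neg.neg ∧ ∀ d : Proof S A.neg.neg, Provable S (mr (d.extract hS) A.neg.neg) :=
  ⟨h.neg_neg_of_classical hac hdns ha, fun d => Provable.mr_extract hS hSac d⟩

open HAOmega in
theorem mainTheorem2 :
    (∀ {Γ : Ctx} {a : Form} (A : Fm Γ a), Provable PA_ACω A →
      Provable HA_ACω_DNSω A.neg.neg ∧
        ∀ d : Proof HA_ACω_DNSω A.neg.neg,
          Provable HA_ACω_DNSω (mr (d.extract not_lem_HA_ACω_DNSω) A.neg.neg)) ∧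
    (∀ {Γ : Ctx} {a : Form} (A : Fm Γ a), a.Arithmetical → Provable PA_AC0 A →
      Provable HA_AC0_DNS0 A.neg.neg ∧
        ∀ d : Proof HA_AC0_DNS0 A.neg.neg,
          Provable HA_AC0_DNS0 (mr (d.extract not_lem_HA_AC0_DNS0) A.neg.neg)) :=
  ⟨fun {_ a} A => mainTheorem2_general (S := HA_ACω_DNSω) (T := PA_ACω) _ (fun _ _ _ => trivial)
      (fun _ _ _ => trivial) (fun _ _ _ => trivial) A (a.forallIn_of_forall fun _ => trivial).1,
    fun A ha => mainTheorem2_general (S := HA_AC0_DNS0) (T := PA_AC0) _ (fun _ _ h => h)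
      (fun _ _ h => h) (fun _ _ h => h) A ha.forallIn.1⟩
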